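/- Let $\Gamma$ be a subgroup of $\mathrm{PSL}(2,\mathbb R)$ (for example a Fuchsian group of the first kind with cusps), let $k\ge 2$ be an even integer, and let $P_{k-2}$ be the space of complex polynomials of degree at most $k-2$, with the right action $(p|_{2-k}\gamma)(X)=(cX+d)^{k-2}\,p\bigl(\tfrac{aX+b}{cX+d}\bigr)$ for $\gamma=\pm\begin{pmatrix}a&b\\c&d\end{pmatrix}$. For a complex vector space $M$ with a linear right action of $\Gamma$, let $C^1(\Gamma,M)$ be the space of all maps $\Gamma\to M$, put $d\psi(\gamma,\delta)=\psi(\delta\gamma)-\psi(\delta)|\gamma-\psi(\gamma)$, let $Z^1(\Gamma,M)=\ker d$, let $B^1(\Gamma,M)$ be the space of the maps $\gamma\mapsto m|(\gamma-1)$ with $m\in M$, let $Z^1_{\mathrm{par}}(\Gamma,M)$ be the space of those $\psi\in Z^1(\Gamma,M)$ with $\psi(\pi)\in M|(\pi-1)$ for every parabolic $\pi\in\Gamma$, and let $H^1_{\mathrm{par}}(\Gamma,M)=Z^1_{\mathrm{par}}(\Gamma,M)/B^1(\Gamma,M)$. If $\Gamma$ acts trivially on $M$, then $B^1(\Gamma,M)=0$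 and $H^1_{\mathrm{par}}(\Gamma,M)=Z^1_{\mathrm{par}}(\Gamma,M)$. Define $\alpha: C^1(\Gamma,P_{k-2})\to C^1(\Gamma,C^1(\Gamma,P_{k-2}))$ by $\alpha(\psi)(\gamma)(\delta)=d\psi(\gamma,\delta)|_{2-k}\gamma^{-1}$. Define subspaces $\mathbf Z^{(t)},\mathbf B^{(t)}$ of $C^1(\Gamma,P_{k-2})$ for $t\in\mathbb Z$ as follows: $\mathbf Z^{(t)}=\mathbf B^{(t)}=0$ for $t<0$; $\mathbf Z^{(0)}=Z^1(\Gamma,P_{k-2})$ and $\mathbf B^{(0)}=B^1(\Gamma,P_{k-2})$; and for $t\ge 1$ $$\mathbf Z^{(t)}=\alpha_t^{-1}H^1_{\mathrm{par}}\bigl(\Gamma,\mathbf Z^{(t-1)}/\mathbf Z^{(t-2)}\bigr),\qquad \mathbf B^{(t)}=\alpha_t^{-1}H^1_{\mathrm{par}}\bigl(\Gamma,\mathbf B^{(t-1)}/\mathbf Z^{(t-2)}\bigr),$$ where $\alpha_t(\psi)(\gamma)$ is the class of $\alpha(\psi)(\gamma)$ in $C^1(\Gamma,P_{k-2})/\mathbf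 Z^{(t-2)}$, the group $\Gamma$ acts trivially on the coefficient spaces, and the groups $H^1_{\mathrm{par}}=Z^1_{\mathrm{par}}$ are regarded as subspaces of $C^1(\Gamma,C^1(\Gamma,P_{k-2})/\mathbf Z^{(t-2)})$. One has $\mathbf Z^{(t-1)}\subseteq \mathbf B^{(t)}\subseteq\mathbf Z^{(t)}$ for all $t$. Put $\mathbf H^{(t)}=\mathbf Z^{(t)}/\mathbf B^{(t)}$, again with the trivial action of $\Gamma$. Proposition. For every integer $t$, the map $i_*: H^1_{\mathrm{par}}(\Gamma,\mathbf B^{(t-1)}/\mathbf Z^{(t-2)})\to H^1_{\mathrm{par}}(\Gamma,\mathbf Z^{(t-1)}/\mathbf Z^{(t-2)})$ induced by the inclusion is injective, and the projection $\mathbf Z^{(t-1)}/\mathbf Z^{(t-2)}\to\mathbf H^{(t-1)}$ induces an isomorphism of complex vector spaces $$\frac{H^1_{\mathrm{par}}(\Gamma,\mathbf Z^{(t-1)}/\mathbf Z^{(t-2)})}{i_*H^1_{\mathrm{par}}(\Gamma,\mathbf B^{(t-1)}/\mathbf Z^{(t-2)})}\;\cong\; H^1_{\mathrm{par}}(\Gamma,\mathbf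 H^{(t-1)}).$$ -/

import Mathlib

open Polynomial
open scoped MatrixGroups MulOpposite

namespace HigherOrder

noncomputable section

/-! ### The module of polynomials of degree at most `n` with its right slash action -/

/-- For `A = (a b; c d)` and a polynomial `p = ∑ pᵢ Xⁱ` of degree at most `n`, the polynomial
`∑ pᵢ (a X + b)ⁱ (c X + d)ⁿ⁻ⁱ`, that is `(c X + d)ⁿ p((a X + b) / (c X + d))`. -/
def slashPoly (n : ℕ) (A : SL(2, ℝ)) : ℂ[X] →ₗ[ℂ] ℂ[X] :=
  ∑ i ∈ Finset.range (n + 1), (lcoeff ℂ i).smulRight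
    ((C ((A 0 0 : ℝ) : ℂ) * X + C ((A 0 1 : ℝ) : ℂ)) ^ i *
      (C ((A 1 0 : ℝ) : ℂ) * X + C ((A 1 1 : ℝ) : ℂ)) ^ (n - i))

/-- `P_{k-2}`: complex polynomials of degree at most `k - 2`. -/
abbrev Poly (k : ℕ) : Submodule ℂ ℂ[X] := degreeLE ℂ ((k - 2 : ℕ) : WithBot ℕ)

theorem slashPoly_apply (n : ℕ) (A : SL(2, ℝ)) (p : ℂ[X]) :
    slashPoly n A p = ∑ i ∈ Finset.range (n + 1), p.coeff i •
      ((C ((A 0 0 : ℝ) : ℂ) * X + C ((A 0 1 : ℝ) : ℂ)) ^ i *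
        (C ((A 1 0 : ℝ) : ℂ) * X + C ((A 1 1 : ℝ) : ℂ)) ^ (n - i)) := by
  simp [slashPoly, LinearMap.sum_apply]

theorem slashPoly_mem (n : ℕ) (A : SL(2, ℝ)) (p : ℂ[X]) :
    slashPoly n A p ∈ degreeLE ℂ (n : WithBot ℕ) := by
  rw [slashPoly_apply]
  refine Submodule.sum_mem _ fun i hi => Submodule.smul_mem _ _ ?_
  rw [mem_degreeLE]
  refine degree_le_of_natDegree_le ?_
  have hi' : i ≤ n := Nat.lt_succ_iff.mp (Finset.mem_range.mp hi)
  refine natDegree_mul_le.trans ?_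
  have h1 := natDegree_pow_le_of_le i
    (natDegree_linear_le (a := ((A 0 0 : ℝ) : ℂ)) (b := ((A 0 1 : ℝ) : ℂ)))
  have h2 := natDegree_pow_le_of_le (n - i)
    (natDegree_linear_le (a := ((A 1 0 : ℝ) : ℂ)) (b := ((A 1 1 : ℝ) : ℂ)))
  omega

theorem slashPoly_eval (n : ℕ) (A : SL(2, ℝ)) (p : ℂ[X]) (hp : p ∈ degreeLE ℂ (n : WithBot ℕ))
    (x : ℂ) (hx : (A 1 0 : ℂ) * x + (A 1 1 : ℂ) ≠ 0) :
    (slashPoly n A p).eval x = ((A 1 0 : ℂ) * x + (A 1 1 : ℂ)) ^ n *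
      p.eval (((A 0 0 : ℂ) * x + (A 0 1 : ℂ)) / ((A 1 0 : ℂ) * x + (A 1 1 : ℂ))) := by
  have hd : p.natDegree < n + 1 :=
    Nat.lt_succ_iff.mpr (natDegree_le_of_degree_le (mem_degreeLE.mp hp))
  rw [eval_eq_sum_range' hd, slashPoly_apply, eval_finsetSum, Finset.mul_sum]
  refine Finset.sum_congr rfl fun i hi => ?_
  have hi' : i ≤ n := Nat.lt_succ_iff.mp (Finset.mem_range.mp hi)
  simp only [eval_smul, eval_mul, eval_pow, eval_add, eval_C, eval_X, smul_eq_mul, div_pow]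
  rw [← pow_sub_mul_pow _ hi']
  generalize (A 1 0 : ℂ) * x + (A 1 1 : ℂ) = v at hx
  field_simp

theorem row_ne_zero (A : SL(2, ℝ)) :
    (C ((A 1 0 : ℝ) : ℂ) * X + C ((A 1 1 : ℝ) : ℂ) : ℂ[X]) ≠ 0 := by
  intro h
  have h0 := congrArg (fun q => coeff q 0) h
  have h1 := congrArg (fun q => coeff q 1) h
  simp [coeff_X, coeff_C] at h0 h1
  have hdet := A.det_coe
  rw [Matrix.det_fin_two, h0, h1] at hdet
  simp at hdet

/-- The slash operator is a right action: `p|(AB) = (p|A)|B`. -/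
theorem slashPoly_mul (n : ℕ) (A B : SL(2, ℝ)) (p : ℂ[X])
    (hp : p ∈ degreeLE ℂ (n : WithBot ℕ)) :
    slashPoly n (A * B) p = slashPoly n B (slashPoly n A p) := by
  have hQ := mul_ne_zero (row_ne_zero B) (row_ne_zero (A * B))
  rw [← sub_eq_zero]
  refine (mul_eq_zero.mp ?_).resolve_right hQ
  refine Polynomial.funext fun x => ?_
  simp only [eval_mul, eval_sub, eval_add, eval_C, eval_X, eval_zero]
  by_cases h1 : (B 1 0 : ℂ) * x + (B 1 1 : ℂ) = 0
  · rw [h1]; simp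
  by_cases h2 : ((A * B) 1 0 : ℂ) * x + ((A * B) 1 1 : ℂ) = 0
  · rw [h2]; simp
  have e : ∀ i, ((A * B) i 0 : ℂ) * x + ((A * B) i 1 : ℂ) =
      ((A i 0 : ℂ) * (((B 0 0 : ℂ) * x + (B 0 1 : ℂ)) / ((B 1 0 : ℂ) * x + (B 1 1 : ℂ))) +
        (A i 1 : ℂ)) * ((B 1 0 : ℂ) * x + (B 1 1 : ℂ)) := by
    intro i
    simp only [Matrix.SpecialLinearGroup.coe_mul, Matrix.mul_apply, Fin.sum_univ_two]
    push_cast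
    field_simp
    ring
  have h3 : (A 1 0 : ℂ) * (((B 0 0 : ℂ) * x + (B 0 1 : ℂ)) / ((B 1 0 : ℂ) * x + (B 1 1 : ℂ))) +
        (A 1 1 : ℂ) ≠ 0 := by
    intro h
    apply h2
    rw [e 1, h, zero_mul]
  rw [slashPoly_eval n (A * B) p hp x h2, slashPoly_eval n B _ (slashPoly_mem n A p) x h1,
    slashPoly_eval n A p hp _ h3, e 0, e 1, mul_div_mul_right _ _ h1, mul_pow]
  ring

theorem slashPoly_scalar (n : ℕ) (hn : Even n) (A : SL(2, ℝ))
    (hA : A ∈ Subgroup.center (SL(2, ℝ))) (p : ℂ[X]) (hp : p ∈ degreeLE ℂ (n : WithBot ℕ)) :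
    slashPoly n A p = p := by
  obtain ⟨r, hr, hA⟩ := Matrix.SpecialLinearGroup.mem_center_iff.mp hA
  have h00 : A 0 0 = r := by rw [← hA]; simp
  have h01 : A 0 1 = 0 := by rw [← hA]; simp
  have h10 : A 1 0 = 0 := by rw [← hA]; simp
  have h11 : A 1 1 = r := by rw [← hA]; simp
  have hr2 : ((r : ℝ) : ℂ) ^ 2 = 1 := by
    rw [Fintype.card_fin] at hr
    exact_mod_cast hr
  have hr0 : ((r : ℝ) : ℂ) ≠ 0 := by
    intro h
    rw [h] at hr2
    simp at hr2
  refine Polynomial.funext fun x => ?_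
  have hx : (A 1 0 : ℂ) * x + (A 1 1 : ℂ) ≠ 0 := by simpa [h10, h11] using hr0
  rw [slashPoly_eval n A p hp x hx, h00, h01, h10, h11]
  obtain ⟨m, rfl⟩ := hn
  have : ((r : ℝ) : ℂ) ^ (m + m) = 1 := by rw [← two_mul, pow_mul, hr2, one_pow]
  simp [this, hr0]

theorem slashPoly_one (n : ℕ) (p : ℂ[X]) (hp : p ∈ degreeLE ℂ (n : WithBot ℕ)) :
    slashPoly n 1 p = p := by
  refine Polynomial.funext fun x => ?_
  rw [slashPoly_eval n 1 p hp x (by simp)]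
  simp

/-- The slash operator `|_{2-k}` of `SL(2, ℝ)` on `P_{k-2}`. It is a right action, so that it is
a homomorphism to the opposite of the ring of endomorphisms. -/
def slashSL (k : ℕ) : SL(2, ℝ) →* (Module.End ℂ (Poly k))ᵐᵒᵖ where
  toFun A := MulOpposite.op ((slashPoly (k - 2) A).restrict fun p _ => slashPoly_mem (k - 2) A p)
  map_one' := by
    apply MulOpposite.unop_injective
    ext1 p
    exact Subtype.ext (slashPoly_one (k - 2) p p.2)
  map_mul' A B := by
    apply MulOpposite.unop_injective
    ext1 p
    exact Subtype.ext (slashPoly_mul (k - 2) A B p p.2)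

/-- For even `k` the slash operator `|_{2-k}` is defined on `PSL(2, ℝ)`. -/
def slashPSL (k : ℕ) (hk : Even k) : PSL(2, ℝ) →* (Module.End ℂ (Poly k))ᵐᵒᵖ :=
  QuotientGroup.lift _ (slashSL k) fun A hA => by
    apply MulOpposite.unop_injective
    ext1 p
    refine Subtype.ext (slashPoly_scalar (k - 2) ?_ A hA p p.2)
    obtain ⟨m, rfl⟩ := hk
    exact ⟨m - 1, by omega⟩

/-! ### Parabolic cohomology

A right action of a group `G` on a vector space `M` is a representation `ρ` of the opposite group:
`m|γ` is `ρ (op γ) m`. -/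

section Cohomology

variable (Γ : Subgroup PSL(2, ℝ)) {M N : Type*} [AddCommGroup M] [Module ℂ M]
  [AddCommGroup N] [Module ℂ N]

/-- The right action `|_{2-k}` of `Γ` on `P_{k-2}`. -/
def slashRep (k : ℕ) (hk : Even k) : Representation ℂ Γᵐᵒᵖ (Poly k) where
  toFun γ := (slashPSL k hk (γ.unop : PSL(2, ℝ))).unop
  map_one' := by simp
  map_mul' γ δ := by simp

/-- An element of `PSL(2, ℝ)` is parabolic if it is the class of a parabolic matrix. -/
def IsParabolicPSL (g : PSL(2, ℝ)) : Prop :=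
  ∃ A : SL(2, ℝ), (QuotientGroup.mk A : PSL(2, ℝ)) = g ∧
    (A : Matrix (Fin 2) (Fin 2) ℝ).IsParabolic

variable {Γ}

/-- The differential on 1-cochains, `(dψ)(γ, δ) = ψ(δγ) - ψ(δ)|γ - ψ(γ)`. -/
def d1 (ρ : Representation ℂ Γᵐᵒᵖ M) : (Γ → M) →ₗ[ℂ] (Γ → Γ → M) where
  toFun ψ γ δ := ψ (δ * γ) - ρ (.op γ) (ψ δ) - ψ γ
  map_add' ψ φ := by
    funext γ δ
    simp only [Pi.add_apply, map_add]
    abel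
  map_smul' c ψ := by
    funext γ δ
    simp [smul_sub]

/-- `Z¹(Γ, M)`. -/
def Z1 (ρ : Representation ℂ Γᵐᵒᵖ M) : Submodule ℂ (Γ → M) := LinearMap.ker (d1 ρ)

/-- The coboundary `γ ↦ m|γ - m` of `m`. -/
def d0 (ρ : Representation ℂ Γᵐᵒᵖ M) : M →ₗ[ℂ] (Γ → M) :=
  LinearMap.pi fun γ => ρ (.op γ) - LinearMap.id

/-- `B¹(Γ, M)`. -/
def B1 (ρ : Representation ℂ Γᵐᵒᵖ M) : Submodule ℂ (Γ → M) := LinearMap.range (d0 ρ)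

/-- The parabolic cocycles `Z¹_par(Γ, M)`: those `ψ` with `ψ(π) ∈ M|(π - 1)` for every parabolic
`π` in `Γ`. -/
def Z1par (ρ : Representation ℂ Γᵐᵒᵖ M) : Submodule ℂ (Γ → M) :=
  Z1 ρ ⊓ ⨅ (π : Γ) (_ : IsParabolicPSL (π : PSL(2, ℝ))),
    (LinearMap.range (ρ (.op π) - LinearMap.id)).comap (LinearMap.proj π)

/-- `H¹_par(Γ, M) = Z¹_par(Γ, M) / B¹(Γ, M)`. -/
abbrev H1par (ρ : Representation ℂ Γᵐᵒᵖ M) : Type _ :=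
  ↥(Z1par ρ) ⧸ (B1 ρ).submoduleOf (Z1par ρ)

theorem comp_mem_Z1par (ρ : Representation ℂ Γᵐᵒᵖ M) (σ : Representation ℂ Γᵐᵒᵖ N)
    (f : M →ₗ[ℂ] N) (hf : ∀ γ m, f (ρ γ m) = σ γ (f m)) (ψ : Γ → M) (hψ : ψ ∈ Z1par ρ) :
    f.compLeft Γ ψ ∈ Z1par σ := by
  simp only [Z1par, Z1, Submodule.mem_inf, Submodule.mem_iInf, LinearMap.mem_ker,
    Submodule.mem_comap, LinearMap.mem_range] at hψ ⊢
  refine ⟨?_, fun π hπ => ?_⟩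
  · funext γ δ
    have h := congrArg f (congrFun (congrFun hψ.1 γ) δ)
    simpa [d1, hf] using h
  · obtain ⟨m, hm⟩ := hψ.2 π hπ
    refine ⟨f m, ?_⟩
    have h := congrArg f hm
    simpa [hf] using h

/-- The map `f_* : H¹_par(Γ, M) → H¹_par(Γ, N)` induced by an equivariant map `f : M → N`. -/
def H1parMap (ρ : Representation ℂ Γᵐᵒᵖ M) (σ : Representation ℂ Γᵐᵒᵖ N)
    (f : M →ₗ[ℂ] N) (hf : ∀ γ m, f (ρ γ m) = σ γ (f m)) : H1par ρ →ₗ[ℂ] H1par σ :=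
  Submodule.mapQ _ _ ((f.compLeft Γ).restrict (comp_mem_Z1par ρ σ f hf)) (by
    rintro ⟨ψ, hψ⟩ ⟨m, hm⟩
    refine ⟨f m, ?_⟩
    funext γ
    have h := congrArg f (congrFun hm γ)
    simpa [d0, hf] using h)

end Cohomology

/-! ### The spaces `Z^{(t)}`, `B^{(t)}` and `H^{(t)}` -/

section Spaces

variable (Γ : Subgroup PSL(2, ℝ)) (k : ℕ) (hk : Even k)

/-- `C¹(Γ, P_{k-2})`. -/
abbrev C1 : Type := Γ → Poly k

variable {Γ k}

/-- The quotient `S / T` of subspaces `T ⊆ S` of a vector space. -/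
abbrev SubQuot {V : Type*} [AddCommGroup V] [Module ℂ V] (S T : Submodule ℂ V) : Type _ :=
  ↥S ⧸ T.submoduleOf S

/-- The inclusion `S / T ⊆ V / T`. -/
def SubQuot.incl {V : Type*} [AddCommGroup V] [Module ℂ V] (S T : Submodule ℂ V) :
    SubQuot S T →ₗ[ℂ] V ⧸ T :=
  Submodule.mapQ _ _ S.subtype le_rfl

/-- The map `R / T → S / T` induced by an inclusion `R ⊆ S`. -/
def SubQuot.map {V : Type*} [AddCommGroup V] [Module ℂ V] {R S : Submodule ℂ V}
    (T : Submodule ℂ V) (h : R ≤ S) : SubQuot R T →ₗ[ℂ] SubQuot S T :=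
  Submodule.mapQ _ _ (Submodule.inclusion h) fun _ hx => hx

/-- The projection `S / T → S / R` for `T ⊆ R`. -/
def SubQuot.proj {V : Type*} [AddCommGroup V] [Module ℂ V] (S : Submodule ℂ V)
    {T R : Submodule ℂ V} (h : T ≤ R) : SubQuot S T →ₗ[ℂ] SubQuot S R :=
  Submodule.mapQ _ _ LinearMap.id fun _ hx => h hx

variable (Γ) in
/-- A vector space with the trivial action of `Γ`. -/
abbrev triv (M : Type*) [AddCommGroup M] [Module ℂ M] : Representation ℂ Γᵐᵒᵖ M :=
  Representation.trivial ℂ Γᵐᵒᵖ M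

/-- `α(ψ)(γ)(δ) = dψ(γ, δ)|_{2-k} γ⁻¹`. -/
def alpha : C1 Γ k →ₗ[ℂ] (Γ → C1 Γ k) :=
  LinearMap.pi fun γ => LinearMap.pi fun δ =>
    slashRep Γ k hk (.op γ⁻¹) ∘ₗ LinearMap.proj δ ∘ₗ LinearMap.proj γ ∘ₗ d1 (slashRep Γ k hk)

/-- The map `C¹(Γ, P_{k-2}) → C¹(Γ, C¹(Γ, P_{k-2}) / T)` obtained from `α` by reduction
modulo `T`. -/
def alphaMod (T : Submodule ℂ (C1 Γ k)) : C1 Γ k →ₗ[ℂ] (Γ → C1 Γ k ⧸ T) :=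
  T.mkQ.compLeft Γ ∘ₗ alpha hk

/-- The preimage under `alphaMod T` of `Z¹_par(Γ, S / T) ⊆ C¹(Γ, C¹(Γ, P_{k-2}) / T)`, where `Γ`
acts trivially. For this action `B¹ = 0`, so that `Z¹_par(Γ, S / T) = H¹_par(Γ, S / T)`. -/
def lift (S T : Submodule ℂ (C1 Γ k)) : Submodule ℂ (C1 Γ k) :=
  ((Z1par (triv Γ (SubQuot S T))).map ((SubQuot.incl S T).compLeft Γ)).comap (alphaMod hk T)

/-- The sequence of the `Z^{(t)}`, indexed by `t + 1`. -/
def Zseq : ℕ → Submodule ℂ (C1 Γ k)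
  | 0 => ⊥
  | 1 => Z1 (slashRep Γ k hk)
  | n + 2 => lift hk (Zseq (n + 1)) (Zseq n)

/-- The sequence of the `B^{(t)}`, indexed by `t + 1`. -/
def Bseq : ℕ → Submodule ℂ (C1 Γ k)
  | 0 => ⊥
  | 1 => B1 (slashRep Γ k hk)
  | n + 2 => lift hk (Bseq (n + 1)) (Zseq hk n)

variable (Γ)

/-- `Z^{(t)}`: zero for `t < 0`, `Z¹(Γ, P_{k-2})` for `t = 0`, and the preimage under `α_t` of
`H¹_par(Γ, Z^{(t-1)} / Z^{(t-2)})` for `t ≥ 1`. -/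
def Zsp (t : ℤ) : Submodule ℂ (C1 Γ k) := Zseq hk (t + 1).toNat

/-- `B^{(t)}`: zero for `t < 0`, `B¹(Γ, P_{k-2})` for `t = 0`, and the preimage under `α_t` of
`H¹_par(Γ, B^{(t-1)} / Z^{(t-2)})` for `t ≥ 1`. -/
def Bsp (t : ℤ) : Submodule ℂ (C1 Γ k) := Bseq hk (t + 1).toNat

/-- `H^{(t)} = Z^{(t)} / B^{(t)}`. -/
abbrev Hsp (t : ℤ) : Type := SubQuot (Zsp Γ hk t) (Bsp Γ hk t)

theorem Zsp_of_neg (t : ℤ) (ht : t < 0) : Zsp Γ hk t = ⊥ := by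
  rw [Zsp, show (t + 1).toNat = 0 by omega, Zseq]

theorem Bsp_of_neg (t : ℤ) (ht : t < 0) : Bsp Γ hk t = ⊥ := by
  rw [Bsp, show (t + 1).toNat = 0 by omega, Bseq]

theorem Zsp_zero : Zsp Γ hk 0 = Z1 (slashRep Γ k hk) := rfl

theorem Bsp_zero : Bsp Γ hk 0 = B1 (slashRep Γ k hk) := rfl

theorem Zsp_of_pos (t : ℤ) (ht : 0 < t) :
    Zsp Γ hk t = lift hk (Zsp Γ hk (t - 1)) (Zsp Γ hk (t - 2)) := by
  obtain ⟨n, rfl⟩ : ∃ n : ℕ, t = n + 1 := ⟨(t - 1).toNat, by omega⟩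
  rw [Zsp, show ((n : ℤ) + 1 + 1).toNat = n + 2 by omega, Zseq, Zsp, Zsp,
    show ((n : ℤ) + 1 - 1 + 1).toNat = n + 1 by omega,
    show ((n : ℤ) + 1 - 2 + 1).toNat = n by omega]

theorem Bsp_of_pos (t : ℤ) (ht : 0 < t) :
    Bsp Γ hk t = lift hk (Bsp Γ hk (t - 1)) (Zsp Γ hk (t - 2)) := by
  obtain ⟨n, rfl⟩ : ∃ n : ℕ, t = n + 1 := ⟨(t - 1).toNat, by omega⟩
  rw [Bsp, show ((n : ℤ) + 1 + 1).toNat = n + 2 by omega, Bseq, Bsp, Zsp,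
    show ((n : ℤ) + 1 - 1 + 1).toNat = n + 1 by omega,
    show ((n : ℤ) + 1 - 2 + 1).toNat = n by omega]

variable {Γ}

theorem B1_le_Z1 : B1 (slashRep Γ k hk) ≤ Z1 (slashRep Γ k hk) := by
  rintro _ ⟨m, rfl⟩
  rw [Z1, LinearMap.mem_ker]
  funext γ δ
  simp [d1, d0]

theorem lift_mono {R S : Submodule ℂ (C1 Γ k)} (T : Submodule ℂ (C1 Γ k)) (h : R ≤ S) :
    lift hk R T ≤ lift hk S T := by
  rintro ψ ⟨u, hu, hψ⟩
  refine ⟨(SubQuot.map T h).compLeft Γ u,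
    comp_mem_Z1par (triv Γ _) (triv Γ _) (SubQuot.map T h) (fun _ _ => rfl) u hu, ?_⟩
  rw [← hψ]
  funext γ
  simp only [LinearMap.compLeft_apply, Function.comp_apply]
  induction u γ using Submodule.Quotient.induction_on with
  | _ x => rfl

theorem Bseq_le_Zseq (n : ℕ) : Bseq (Γ := Γ) hk n ≤ Zseq hk n := by
  induction n using Nat.strong_induction_on with
  | _ n ih =>
    match n, ih with
    | 0, _ => exact le_rfl
    | 1, _ => exact B1_le_Z1 hk
    | n + 2, ih => exact lift_mono hk _ (ih (n + 1) (by omega))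

theorem mem_lift_of_alphaMod_eq_zero {S T : Submodule ℂ (C1 Γ k)} {ψ : C1 Γ k}
    (h : ∀ γ, alpha hk ψ γ ∈ T) : ψ ∈ lift hk S T := by
  refine ⟨0, Submodule.zero_mem _, ?_⟩
  funext γ
  rw [map_zero]
  exact ((Submodule.Quotient.mk_eq_zero T).mpr (h γ)).symm

theorem alpha_mem_of_mem_lift {S T : Submodule ℂ (C1 Γ k)} (hTS : T ≤ S) {ψ : C1 Γ k}
    (h : ψ ∈ lift hk S T) (γ : Γ) : alpha hk ψ γ ∈ S := by
  obtain ⟨u, -, hu⟩ := h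
  have hγ := congrFun hu γ
  obtain ⟨s, hs⟩ := Submodule.Quotient.mk_surjective _ (u γ)
  have h2 : T.mkQ (s : C1 Γ k) = T.mkQ (alpha hk ψ γ) := by
    rw [LinearMap.compLeft_apply, Function.comp_apply, ← hs] at hγ
    exact hγ
  have h3 := (Submodule.Quotient.eq T).mp h2
  have h4 := S.sub_mem s.2 (hTS h3)
  simpa using h4

theorem Zseq_le_Bseq_succ (n : ℕ) : Zseq (Γ := Γ) hk n ≤ Bseq hk (n + 1) := by
  induction n using Nat.strong_induction_on with
  | _ n ih =>
    match n, ih with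
    | 0, _ => exact bot_le
    | 1, _ =>
      intro ψ hψ
      refine mem_lift_of_alphaMod_eq_zero hk fun γ => ?_
      have h0 : d1 (slashRep Γ k hk) ψ = 0 := hψ
      have : alpha hk ψ γ = 0 := by
        funext δ
        simp [alpha, h0]
      rw [this]
      exact Submodule.zero_mem _
    | n + 2, ih =>
      intro ψ hψ
      refine mem_lift_of_alphaMod_eq_zero hk fun γ => ?_
      exact alpha_mem_of_mem_lift hk
        ((ih n (by omega)).trans (Bseq_le_Zseq hk (n + 1))) hψ γ

variable (Γ)

theorem Bsp_le_Zsp (t : ℤ) : Bsp Γ hk t ≤ Zsp Γ hk t := Bseq_le_Zseq hk _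

theorem Zsp_le_Bsp (t : ℤ) : Zsp Γ hk (t - 2) ≤ Bsp Γ hk (t - 1) := by
  by_cases ht : t < 1
  · rw [Zsp_of_neg Γ hk (t - 2) (by omega)]
    exact bot_le
  · have h := Zseq_le_Bseq_succ (Γ := Γ) hk (t - 2 + 1).toNat
    rwa [show (t - 2 + 1).toNat + 1 = (t - 1 + 1).toNat by omega] at h

/-- The map `i_* : H¹_par(Γ, B^{(t-1)} / Z^{(t-2)}) → H¹_par(Γ, Z^{(t-1)} / Z^{(t-2)})` induced by
the inclusion, for the trivial actions. -/
def inclStar (t : ℤ) :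
    H1par (triv Γ (SubQuot (Bsp Γ hk (t - 1)) (Zsp Γ hk (t - 2)))) →ₗ[ℂ]
      H1par (triv Γ (SubQuot (Zsp Γ hk (t - 1)) (Zsp Γ hk (t - 2)))) :=
  H1parMap _ _ (SubQuot.map (Zsp Γ hk (t - 2)) (Bsp_le_Zsp Γ hk (t - 1))) fun _ _ => rfl

/-- The map `p_* : H¹_par(Γ, Z^{(t-1)} / Z^{(t-2)}) → H¹_par(Γ, H^{(t-1)})` induced by the
projection, for the trivial actions. -/
def projStar (t : ℤ) :
    H1par (triv Γ (SubQuot (Zsp Γ hk (t - 1)) (Zsp Γ hk (t - 2)))) →ₗ[ℂ]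
      H1par (triv Γ (Hsp Γ hk (t - 1))) :=
  H1parMap _ _ (SubQuot.proj (Zsp Γ hk (t - 1)) (Zsp_le_Bsp Γ hk t)) fun _ _ => rfl

end Spaces

end

end HigherOrder

/-! For a trivial action all coboundaries vanish, so `H¹_par(Γ, M)` is the space of homomorphisms
from `Γ` to `M` that vanish on the parabolic elements, and it is functorial in `M` for all linear
maps. Short exact sequences of vector spaces split, hence the functor `H¹_par(Γ, ·)` is exact on
them: a retraction of the injection gives injectivity (`trivMap_injective`) and exactness in the
middle (`ker_trivMap_eq_range`), and a section of the surjection gives surjectivity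
(`trivMap_surjective`). The proposition is this applied to
`0 → B^{(t-1)} / Z^{(t-2)} → Z^{(t-1)} / Z^{(t-2)} → H^{(t-1)} → 0`
and the first isomorphism theorem. -/

namespace HigherOrder

section TrivialAction

variable {Γ : Subgroup PSL(2, ℝ)} {L M N : Type*} [AddCommGroup L] [Module ℂ L]
  [AddCommGroup M] [Module ℂ M] [AddCommGroup N] [Module ℂ N]

theorem B1_triv : B1 (triv Γ M) = ⊥ := by
  rw [eq_bot_iff]
  rintro _ ⟨m, rfl⟩
  rw [Submodule.mem_bot]
  funext γ
  simp [d0]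

/-- For a trivial action a class in `H¹_par` is zero only if the cocycle itself is. -/
theorem H1par_mk_eq_zero_iff (ψ : Z1par (triv Γ M)) :
    (Submodule.Quotient.mk ψ : H1par (triv Γ M)) = 0 ↔ (ψ : Γ → M) = 0 := by
  rw [Submodule.Quotient.mk_eq_zero, Submodule.submoduleOf, Submodule.mem_comap, B1_triv,
    Submodule.mem_bot]
  rfl

/-- The map induced on `H¹_par` by a linear map, for trivial actions. -/
noncomputable abbrev trivMap (Γ : Subgroup PSL(2, ℝ)) (f : M →ₗ[ℂ] N) :
    H1par (triv Γ M) →ₗ[ℂ] H1par (triv Γ N) :=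
  H1parMap (triv Γ M) (triv Γ N) f fun _ _ => rfl

theorem trivMap_mk (f : M →ₗ[ℂ] N) (ψ : Z1par (triv Γ M)) :
    trivMap Γ f (Submodule.Quotient.mk ψ) = Submodule.Quotient.mk
      ⟨f.compLeft Γ ψ, comp_mem_Z1par _ (triv Γ N) f (fun _ _ => rfl) ψ ψ.2⟩ :=
  rfl

theorem trivMap_leftInverse {f : M →ₗ[ℂ] N} {r : N →ₗ[ℂ] M} (h : r ∘ₗ f = LinearMap.id) :
    Function.LeftInverse (trivMap Γ r) (trivMap Γ f) := by
  intro x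
  induction x using Submodule.Quotient.induction_on with
  | _ ψ =>
    rw [trivMap_mk, trivMap_mk]
    refine congrArg _ (Subtype.ext ?_)
    funext γ
    exact LinearMap.congr_fun h (ψ.1 γ)

theorem trivMap_injective {f : M →ₗ[ℂ] N} (hf : Function.Injective f) :
    Function.Injective (trivMap Γ f) := by
  obtain ⟨r, hr⟩ := f.exists_leftInverse_of_injective (LinearMap.ker_eq_bot.mpr hf)
  exact (trivMap_leftInverse hr).injective

theorem trivMap_surjective {g : M →ₗ[ℂ] N} (hg : Function.Surjective g) :
    Function.Surjective (trivMap Γ g) := by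
  obtain ⟨s, hs⟩ := g.exists_rightInverse_of_surjective (LinearMap.range_eq_top.mpr hg)
  exact (trivMap_leftInverse hs).surjective

theorem ker_trivMap_eq_range {f : L →ₗ[ℂ] M} {g : M →ₗ[ℂ] N} (hf : Function.Injective f)
    (hfg : Function.Exact f g) :
    LinearMap.ker (trivMap Γ g) = LinearMap.range (trivMap Γ f) := by
  obtain ⟨r, hr⟩ := f.exists_leftInverse_of_injective (LinearMap.ker_eq_bot.mpr hf)
  refine le_antisymm (fun x hx => ?_) ?_
  · induction x using Submodule.Quotient.induction_on with
    | _ ψ =>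
      rw [LinearMap.mem_ker, trivMap_mk, H1par_mk_eq_zero_iff] at hx
      -- The values of `ψ` lie in the range of `f`, on which `f ∘ r` is the identity.
      refine ⟨trivMap Γ r (Submodule.Quotient.mk ψ), ?_⟩
      rw [trivMap_mk, trivMap_mk]
      refine congrArg _ (Subtype.ext ?_)
      funext γ
      obtain ⟨y, hy⟩ := (hfg (ψ.1 γ)).mp (congrFun hx γ)
      change f (r (ψ.1 γ)) = ψ.1 γ
      rw [← hy]
      exact congrArg f (LinearMap.congr_fun hr y)
  · rintro _ ⟨x, rfl⟩
    induction x using Submodule.Quotient.induction_on with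
    | _ ψ =>
      rw [LinearMap.mem_ker, trivMap_mk, trivMap_mk, H1par_mk_eq_zero_iff]
      funext γ
      exact hfg.apply_apply_eq_zero (ψ.1 γ)

end TrivialAction

section SubQuot

variable {V : Type*} [AddCommGroup V] [Module ℂ V] {T R S : Submodule ℂ V}

theorem SubQuot.map_injective (h : R ≤ S) : Function.Injective (SubQuot.map T h) := by
  rw [injective_iff_map_eq_zero]
  intro x hx
  induction x using Submodule.Quotient.induction_on with
  | _ x =>
    have hx' := (Submodule.Quotient.mk_eq_zero _).mp hx
    exact (Submodule.Quotient.mk_eq_zero _).mpr hx'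

theorem SubQuot.proj_surjective (h : T ≤ R) : Function.Surjective (SubQuot.proj S h) := by
  intro x
  induction x using Submodule.Quotient.induction_on with
  | _ x => exact ⟨Submodule.Quotient.mk x, rfl⟩

theorem SubQuot.exact_map_proj (hTR : T ≤ R) (hRS : R ≤ S) :
    Function.Exact (SubQuot.map T hRS) (SubQuot.proj S hTR) := by
  intro x
  induction x using Submodule.Quotient.induction_on with
  | _ x =>
    refine ⟨fun hx => ?_, ?_⟩
    · have hx' : (x : V) ∈ R := (Submodule.Quotient.mk_eq_zero (R.submoduleOf S)).mp hx
      exact ⟨Submodule.Quotient.mk ⟨x, hx'⟩, rfl⟩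
    · rintro ⟨y, hy⟩
      rw [← hy]
      induction y using Submodule.Quotient.induction_on with
      | _ y => exact (Submodule.Quotient.mk_eq_zero _).mpr y.2

end SubQuot

end HigherOrder

theorem mainTheorem7 (Γ : Subgroup (Matrix.ProjectiveSpecialLinearGroup (Fin 2) ℝ))
    (k : ℕ) (hk : Even k) (hk2 : 2 ≤ k) (t : ℤ) :
    Function.Injective (HigherOrder.inclStar Γ hk t) ∧
    ∃ e : (HigherOrder.H1par (HigherOrder.triv Γ
          (HigherOrder.SubQuot (HigherOrder.Zsp Γ hk (t - 1)) (HigherOrder.Zsp Γ hk (t - 2)))) ⧸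
          LinearMap.range (HigherOrder.inclStar Γ hk t)) ≃ₗ[ℂ]
        HigherOrder.H1par (HigherOrder.triv Γ (HigherOrder.Hsp Γ hk (t - 1))),
      ∀ x, e (Submodule.Quotient.mk x) = HigherOrder.projStar Γ hk t x := by
  have hinj := HigherOrder.SubQuot.map_injective (T := HigherOrder.Zsp Γ hk (t - 2))
    (HigherOrder.Bsp_le_Zsp Γ hk (t - 1))
  have hsurj : Function.Surjective (HigherOrder.projStar Γ hk t) :=
    HigherOrder.trivMap_surjective
      (HigherOrder.SubQuot.proj_surjective (HigherOrder.Zsp_le_Bsp Γ hk t))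
  have hker : LinearMap.range (HigherOrder.inclStar Γ hk t) =
      LinearMap.ker (HigherOrder.projStar Γ hk t) :=
    (HigherOrder.ker_trivMap_eq_range hinj (HigherOrder.SubQuot.exact_map_proj
      (HigherOrder.Zsp_le_Bsp Γ hk t) (HigherOrder.Bsp_le_Zsp Γ hk (t - 1)))).symm
  exact ⟨HigherOrder.trivMap_injective hinj,
    (Submodule.quotEquivOfEq _ _ hker).trans
      ((HigherOrder.projStar Γ hk t).quotKerEquivOfSurjective hsurj), fun _ => rfl⟩
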